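/- Let $N\ge 1$, let $X$ be a (real or complex) Banach space, let $p\in\{0\}\cup[1,\infty]$, and let $\mathbf X=l^p(\mathbb Z^N,X)$ with the usual $p$-norm, where $l^0(\mathbb Z^N,X)$ denotes the closure in $l^\infty(\mathbb Z^N,X)$ of the finitely supported sequences. Let $P_n$ be the operator on $\mathbf X$ of multiplication by the characteristic function of $\{-n,\dots,n\}^N$, and for $\alpha\in\mathbb Z^N$ let $V_\alpha$ be the shift $(V_\alpha x)_i=x_{i-\alpha}$. A bounded linear operator $K$ on $\mathbf X$ is $\mathcal P$-compact if $\|(I-P_n)K\|+\|K(I-P_n)\|\to0$; $\mathcal L(\mathbf X,\mathcal P)$ is the set of bounded linear operators $A$ on $\mathbf X$ such that $AK$ and $KA$ are $\mathcal P$-compact for every $\mathcal P$-compact $K$. A bounded sequence $(A_n)$ in $\mathcal L(\mathbf X,\mathcal P)$ converges $\mathcal P$-strongly to a bounded linear operator $B$ if $\|P_m(A_n-B)\|+\|(A_n-B)P_m\|\to0$ as $n\to\infty$ for every $m$. A band operator is a finite sum $\sum_\alpha a_\alpha V_\alpha$ with multiplication operators $(a_\alpha x)_i=a_\alpha(i)x_i$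 for bounded $a_\alpha:\mathbb Z^N\to\mathcal L(X)$, and an operator is band-dominated if it is an operator-norm limit of band operators. For $A\in\mathcal L(\mathbf X,\mathcal P)$ and a sequence $h=(h_n)$ in $\mathbb Z^N$ with $|h_n|\to\infty$, the limit operator $A_h$ is the $\mathcal P$-strong limit of $V_{-h_n}AV_{h_n}$, if it exists; the operator spectrum $\sigma_{\mathrm{op}}(A)$ is the set of all limit operators of $A$; and $A$ is rich if every sequence $h$ with $|h_n|\to\infty$ has a subsequence $g$ for which $A_g$ exists. The lower norm of a bounded linear operator $B$ on $\mathbf X$ is $\nu(B)=\inf\{\|Bx\|:\|x\|=1\}$ (by convention $0$ if $\mathbf X=\{0\}$). Theorem. Let $A$ be a rich band-dominated operator on $\mathbf X$. Then there exists $C\in\sigma_{\mathrm{op}}(A)$ with $$\nu(C)=\min\{\nu(B):B\in\sigma_{\mathrm{op}}(A)\}.$$ -/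

import Mathlib

open Filter Topology

noncomputable section

namespace LimitOperator

/-- The index lattice `ℤ^N`; its norm `‖i‖` is the maximum norm. -/
abbrev Lattice (N : ℕ) : Type := Fin N → ℤ

/-- The parameter `p` ranges over `{0} ∪ [1, ∞]`, where `p = 0` stands for the sequences vanishing
at infinity, normed by the supremum norm; `normExponent p` is the exponent of the norm. -/
def normExponent (p : ENNReal) : ENNReal := if p = 0 then ⊤ else p

instance fact_one_le_normExponent {p : ENNReal} [hp : Fact (p = 0 ∨ 1 ≤ p)] :
    Fact (1 ≤ normExponent p) := by
  refine ⟨?_⟩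
  unfold normExponent
  split_ifs with h
  · exact le_top
  · exact hp.out.resolve_left h

section lpOperators

/-- The usual space of `q`-summable (bounded, if `q = ∞`) families `(x_i)` indexed by `ℤ^N`. -/
abbrev Seq (X : Type*) [NormedAddCommGroup X] (N : ℕ) (q : ENNReal) : Type _ :=
  lp (fun _ : Lattice N => X) q

variable (𝕜 : Type*) [RCLike 𝕜] (X : Type*) [NormedAddCommGroup X] [NormedSpace 𝕜 X]
variable (N : ℕ) (q : ENNReal)

/-- The finitely supported sequences. -/
def finSupp : Submodule 𝕜 (Seq X N q) where
  carrier := {x | {i | x i ≠ 0}.Finite}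
  zero_mem' := by simp
  add_mem' := by
    intro x y hx hy
    refine (Set.Finite.union hx hy).subset ?_
    intro i hi
    by_contra h
    simp only [Set.mem_union, Set.mem_ofPred_eq, not_or, not_not] at h
    exact hi (by simp [h.1, h.2])
  smul_mem' := by
    intro c x hx
    refine Set.Finite.subset hx ?_
    intro i hi h
    exact hi (by simp [h])

variable {𝕜 X N q}

theorem memℓp_mul (a : lp (fun _ : Lattice N => X →L[𝕜] X) ⊤) (x : Seq X N q) :
    Memℓp (fun i => a i (x i)) q := by
  refine ((lp.memℓp x).norm.const_smul ‖a‖).mono ?_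
  intro i
  exact (ContinuousLinearMap.le_opNorm _ _).trans
    (mul_le_mul_of_nonneg_right (lp.norm_apply_le_norm ENNReal.top_ne_zero a i) (norm_nonneg _))

variable [Fact (1 ≤ q)]

/-- A bounded linear map that preserves finite supports also preserves their closure. -/
theorem map_closure_finSupp (T : Seq X N q →L[𝕜] Seq X N q)
    (hT : ∀ x ∈ finSupp 𝕜 X N q, T x ∈ finSupp 𝕜 X N q) :
    ∀ x ∈ (finSupp 𝕜 X N q).topologicalClosure,
      T x ∈ (finSupp 𝕜 X N q).topologicalClosure := by
  intro x hx
  exact map_mem_closure T.continuous hx hT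

/-- Multiplication by a bounded family `a` of operators on `X`: `(a x)_i = a_i x_i`. -/
def lpMul (a : lp (fun _ : Lattice N => X →L[𝕜] X) ⊤) : Seq X N q →L[𝕜] Seq X N q :=
  LinearMap.mkContinuous
    { toFun := fun x => (⟨fun i => a i (x i), memℓp_mul a x⟩ : Seq X N q)
      map_add' := by
        intro x y
        ext i
        exact map_add (a i) (x i) (y i)
      map_smul' := by
        intro c x
        ext i
        exact map_smul (a i) c (x i) }
    ‖a‖ (by
      intro x
      have hq : q ≠ 0 := (zero_lt_one.trans_le (Fact.out : 1 ≤ q)).ne'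
      have h1 : ‖(⟨fun i => a i (x i), memℓp_mul a x⟩ : Seq X N q)‖ ≤ ‖‖a‖ • lp.toNorm x‖ := by
        refine lp.norm_mono hq ?_
        intro i
        have h2 : ‖a i (x i)‖ ≤ ‖a‖ * ‖x i‖ := (ContinuousLinearMap.le_opNorm _ _).trans
          (mul_le_mul_of_nonneg_right (lp.norm_apply_le_norm ENNReal.top_ne_zero a i)
            (norm_nonneg _))
        exact h2.trans (le_abs_self _)
      rwa [lp.norm_const_smul hq, norm_norm, lp.norm_toNorm] at h1)

theorem memℓp_shift (α : Lattice N) (x : Seq X N q) : Memℓp (fun i => x (i - α)) q := by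
  have hq : (1 : ENNReal) ≤ q := Fact.out
  rcases q.trichotomy with rfl | rfl | h
  · simp at hq
  · obtain ⟨C, hC⟩ := (lp.memℓp x).bddAbove
    refine memℓp_infty ⟨C, ?_⟩
    rintro _ ⟨i, rfl⟩
    exact hC ⟨i - α, rfl⟩
  · exact memℓp_gen
      ((Equiv.summable_iff (Equiv.subRight α)).2 ((lp.memℓp x).summable h))

theorem norm_shift_le (α : Lattice N) (x : Seq X N q) :
    ‖(⟨fun i => x (i - α), memℓp_shift α x⟩ : Seq X N q)‖ ≤ 1 * ‖x‖ := by
  have hq : (1 : ENNReal) ≤ q := Fact.out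
  rw [one_mul]
  rcases q.trichotomy with rfl | rfl | h
  · simp at hq
  · exact lp.norm_le_of_forall_le (norm_nonneg _)
      (fun i => lp.norm_apply_le_norm ENNReal.top_ne_zero x (i - α))
  · refine lp.norm_le_of_tsum_le h (norm_nonneg _) ?_
    rw [lp.norm_rpow_eq_tsum h x]
    exact ((Equiv.subRight α).tsum_eq (fun i => ‖x i‖ ^ q.toReal)).le

variable (𝕜) in
/-- The shift `(V_α x)_i = x_{i - α}`. -/
def lpShift (α : Lattice N) : Seq X N q →L[𝕜] Seq X N q :=
  LinearMap.mkContinuous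
    { toFun := fun x => (⟨fun i => x (i - α), memℓp_shift α x⟩ : Seq X N q)
      map_add' := by
        intro x y
        ext i
        rfl
      map_smul' := by
        intro c x
        ext i
        rfl }
    1 (norm_shift_le α)

@[simp] theorem lpMul_apply (a : lp (fun _ : Lattice N => X →L[𝕜] X) ⊤) (x : Seq X N q)
    (i : Lattice N) : lpMul a x i = a i (x i) := rfl

@[simp] theorem lpShift_apply (α : Lattice N) (x : Seq X N q) (i : Lattice N) :
    lpShift 𝕜 α x i = x (i - α) := rfl

theorem lpMul_mem_finSupp (a : lp (fun _ : Lattice N => X →L[𝕜] X) ⊤) :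
    ∀ x ∈ finSupp 𝕜 X N q, lpMul a x ∈ finSupp 𝕜 X N q := by
  intro x hx
  refine Set.Finite.subset hx ?_
  intro i hi h
  exact hi (by simp [h])

theorem lpShift_mem_finSupp (α : Lattice N) :
    ∀ x ∈ finSupp 𝕜 X N q, lpShift 𝕜 α x ∈ finSupp 𝕜 X N q := by
  intro x hx
  exact Set.Finite.preimage (sub_left_injective (b := α)).injOn hx

end lpOperators

section SequenceSpace

variable (𝕜 : Type*) [RCLike 𝕜] (X : Type*) [NormedAddCommGroup X] [NormedSpace 𝕜 X]
variable (N : ℕ) (p : ENNReal) [Fact (p = 0 ∨ 1 ≤ p)]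

/-- `l^p(ℤ^N, X)` as a subspace of the sequences of finite norm: everything if `p ≥ 1`, and the
closure of the finitely supported sequences in `l^∞(ℤ^N, X)` if `p = 0`. -/
def seqSubmodule : Submodule 𝕜 (Seq X N (normExponent p)) :=
  if p = 0 then (finSupp 𝕜 X N (normExponent p)).topologicalClosure else ⊤

/-- The sequence space `l^p(ℤ^N, X)`, `p ∈ {0} ∪ [1, ∞]`. -/
def SeqSpace : Type _ := seqSubmodule 𝕜 X N p

instance : NormedAddCommGroup (SeqSpace 𝕜 X N p) :=
  inferInstanceAs (NormedAddCommGroup (seqSubmodule 𝕜 X N p))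

instance : NormedSpace 𝕜 (SeqSpace 𝕜 X N p) :=
  inferInstanceAs (NormedSpace 𝕜 (seqSubmodule 𝕜 X N p))

variable {𝕜 X N p}

theorem map_seqSubmodule (T : Seq X N (normExponent p) →L[𝕜] Seq X N (normExponent p))
    (hT : ∀ x ∈ finSupp 𝕜 X N (normExponent p), T x ∈ finSupp 𝕜 X N (normExponent p)) :
    ∀ x ∈ seqSubmodule 𝕜 X N p, T x ∈ seqSubmodule 𝕜 X N p := by
  unfold seqSubmodule
  split_ifs with h
  · exact map_closure_finSupp T hT
  · exact fun _ _ => Submodule.mem_top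

variable (p) in
/-- The multiplication operator `a I` on `l^p(ℤ^N, X)` for `a ∈ l^∞(ℤ^N, L(X))`. -/
def mulOp (a : lp (fun _ : Lattice N => X →L[𝕜] X) ⊤) :
    SeqSpace 𝕜 X N p →L[𝕜] SeqSpace 𝕜 X N p :=
  (lpMul a).restrict (map_seqSubmodule (lpMul a) (lpMul_mem_finSupp a))

variable (𝕜 X p) in
/-- The shift operator `V_α` on `l^p(ℤ^N, X)`. -/
def shift (α : Lattice N) : SeqSpace 𝕜 X N p →L[𝕜] SeqSpace 𝕜 X N p :=
  (lpShift 𝕜 α).restrict (map_seqSubmodule (lpShift 𝕜 α) (lpShift_mem_finSupp α))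

theorem mulOp_apply (a : lp (fun _ : Lattice N => X →L[𝕜] X) ⊤) (x : SeqSpace 𝕜 X N p)
    (i : Lattice N) : (mulOp p a x).1 i = a i (x.1 i) := rfl

theorem shift_apply (α : Lattice N) (x : SeqSpace 𝕜 X N p) (i : Lattice N) :
    (shift 𝕜 X p α x).1 i = x.1 (i - α) := rfl

variable (𝕜 X) in
/-- The characteristic function of a set `F ⊆ ℤ^N`, with values `0` and the identity of `X`. -/
def charFun (F : Set (Lattice N)) : lp (fun _ : Lattice N => X →L[𝕜] X) ⊤ :=
  ⟨F.indicator (fun _ => ContinuousLinearMap.id 𝕜 X), by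
    refine memℓp_infty ⟨1, ?_⟩
    rintro _ ⟨i, rfl⟩
    exact (norm_indicator_le_norm_self _ _).trans ContinuousLinearMap.norm_id_le⟩

variable (𝕜 X N p) in
/-- The projection `P_n`: multiplication by the characteristic function of `{-n, …, n}^N`. -/
def proj (n : ℕ) : SeqSpace 𝕜 X N p →L[𝕜] SeqSpace 𝕜 X N p :=
  mulOp p (charFun 𝕜 X {i | ∀ j, -(n : ℤ) ≤ i j ∧ i j ≤ n})

/-- `K` is `𝒫`-compact. -/
def IsPCompact (K : SeqSpace 𝕜 X N p →L[𝕜] SeqSpace 𝕜 X N p) : Prop :=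
  Tendsto (fun n => ‖(1 - proj 𝕜 X N p n) * K‖ + ‖K * (1 - proj 𝕜 X N p n)‖) atTop (𝓝 0)

/-- `A` belongs to the class `L(l^p(ℤ^N, X), 𝒫)`. -/
def IsPCompatible (A : SeqSpace 𝕜 X N p →L[𝕜] SeqSpace 𝕜 X N p) : Prop :=
  ∀ K : SeqSpace 𝕜 X N p →L[𝕜] SeqSpace 𝕜 X N p,
    IsPCompact K → IsPCompact (A * K) ∧ IsPCompact (K * A)

/-- The sequence `A` is bounded, lies in `L(l^p(ℤ^N, X), 𝒫)`, and converges `𝒫`-strongly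
to `B`. -/
def PTendsto (A : ℕ → SeqSpace 𝕜 X N p →L[𝕜] SeqSpace 𝕜 X N p)
    (B : SeqSpace 𝕜 X N p →L[𝕜] SeqSpace 𝕜 X N p) : Prop :=
  (∀ n, IsPCompatible (A n)) ∧ (∃ c : ℝ, ∀ n, ‖A n‖ ≤ c) ∧
    ∀ m, Tendsto (fun n => ‖proj 𝕜 X N p m * (A n - B)‖ + ‖(A n - B) * proj 𝕜 X N p m‖)
      atTop (𝓝 0)

/-- `A` is a band operator: a finite sum of operators `a_α V_α`. -/
def IsBand (A : SeqSpace 𝕜 X N p →L[𝕜] SeqSpace 𝕜 X N p) : Prop :=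
  ∃ (S : Finset (Lattice N)) (a : Lattice N → lp (fun _ : Lattice N => X →L[𝕜] X) ⊤),
    A = ∑ α ∈ S, mulOp p (a α) * shift 𝕜 X p α

/-- `A` is band-dominated: a limit, in the operator norm, of band operators. -/
def IsBandDominated (A : SeqSpace 𝕜 X N p →L[𝕜] SeqSpace 𝕜 X N p) : Prop :=
  A ∈ closure {B : SeqSpace 𝕜 X N p →L[𝕜] SeqSpace 𝕜 X N p | IsBand B}

/-- The sequence `h` in `ℤ^N` tends to infinity. -/
def TendsToInfinity (h : ℕ → Lattice N) : Prop := Tendsto (fun n => ‖h n‖) atTop atTop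

/-- `B` is the limit operator `A_h = 𝒫-lim V_{-h_n} A V_{h_n}` (in particular, `A_h` exists). -/
def IsLimitOperator (A : SeqSpace 𝕜 X N p →L[𝕜] SeqSpace 𝕜 X N p) (h : ℕ → Lattice N)
    (B : SeqSpace 𝕜 X N p →L[𝕜] SeqSpace 𝕜 X N p) : Prop :=
  PTendsto (fun n => shift 𝕜 X p (-h n) * A * shift 𝕜 X p (h n)) B

/-- The operator spectrum: the set of all limit operators of `A`. -/
def operatorSpectrum (A : SeqSpace 𝕜 X N p →L[𝕜] SeqSpace 𝕜 X N p) :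
    Set (SeqSpace 𝕜 X N p →L[𝕜] SeqSpace 𝕜 X N p) :=
  {B | ∃ h : ℕ → Lattice N, TendsToInfinity h ∧ IsLimitOperator A h B}

/-- `A ∈ L(l^p(ℤ^N, X), 𝒫)` is rich: every sequence tending to infinity has a subsequence with
respect to which the limit operator of `A` exists. -/
def IsRich (A : SeqSpace 𝕜 X N p →L[𝕜] SeqSpace 𝕜 X N p) : Prop :=
  IsPCompatible A ∧ ∀ h : ℕ → Lattice N, TendsToInfinity h →
    ∃ φ : ℕ → ℕ, StrictMono φ ∧ ∃ B, IsLimitOperator A (h ∘ φ) B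

end SequenceSpace

/-- The lower norm `ν(A) = inf {‖A y‖ : ‖y‖ = 1}` (equal to `0` if `Y = {0}`). -/
def lowerNorm {𝕜 Y Z : Type*} [RCLike 𝕜] [NormedAddCommGroup Y] [NormedSpace 𝕜 Y]
    [NormedAddCommGroup Z] [NormedSpace 𝕜 Z] (A : Y →L[𝕜] Z) : ℝ :=
  sInf {r : ℝ | ∃ y : Y, ‖y‖ = 1 ∧ r = ‖A y‖}

end LimitOperator

end

open Filter Topology

noncomputable section

namespace LimitOperator

/-! ### Tent functions: height, support and slow variation -/

section Tents

variable {N : ℕ} {q : ENNReal}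

/-! Let `μ` be the infimum of the lower norms. Limit operators with lower norm close to `μ` give
almost minimizers of `A` itself: cut an almost minimizer down to bounded support and translate it
far out (`exists_far_of_mem_operatorSpectrum`). The supports may grow along a minimizing sequence,
so translating back need not produce one vector bound that survives the limit.

The remedy is localization with a radius independent of the vector. By a Fubini identity
(`convolution_norm`) the norms of the pieces `t(· - k) x` form a sequence of norm `‖t‖ * ‖x‖`, and
`A` nearly commutes with a wide tent `t`. Hence some piece is almost as good as `x`, with loss `ε`
and support radius depending on `ε` and `A` only.

Iterating with losses `(1/2)^n, ..., (1/2)^0` yields nested supports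
(`IsBandDominated.nested_localization`); a point `h` of the innermost one belongs to all of them.
Seen from `h`, the level `j` piece has radius depending on `j` alone and total loss below `2 *
(1/2)^j`. Richness gives a limit operator `C` along such points `h n`, and each fixed level `j`
passes to the limit: `lowerNorm C ≤ μ + 2 * (1/2)^j`. -/

theorem exponent_ne_zero [Fact (1 ≤ q)] : q ≠ 0 := (zero_lt_one.trans_le (Fact.out : 1 ≤ q)).ne'

theorem finite_norm_le (N : ℕ) (r : ℝ) : {i : Lattice N | ‖i‖ ≤ r}.Finite := by
  have h := (isCompact_closedBall (0 : Lattice N) r).finite_of_discrete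
  simpa [Metric.closedBall, dist_zero_right] using h

/-- A real function of bounded support as an element of `l^q`. -/
def ofBoundedSupport (q : ENNReal) (f : Lattice N → ℝ) (r : ℝ) (hf : ∀ i, f i ≠ 0 → ‖i‖ ≤ r) :
    Seq ℝ N q :=
  ⟨f, (memℓp_zero ((finite_norm_le N r).subset hf)).of_exponent_ge bot_le⟩

open Classical in
/-- The characteristic function of the cube of radius `m`. -/
def boxFun (N : ℕ) (q : ENNReal) (m : ℕ) : Seq ℝ N q :=
  ofBoundedSupport q (fun i => if ‖i‖ ≤ m then 1 else 0) m (by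
    intro i hi
    by_contra h
    exact hi (if_neg h))

/-- The function `i ↦ max (2m - ‖i‖, 0)`. -/
def tent (N : ℕ) (q : ENNReal) (m : ℕ) : Seq ℝ N q :=
  ofBoundedSupport q (fun i => max (2 * m - ‖i‖) 0) (2 * m) (by
    intro i hi
    by_contra h
    push Not at h
    exact hi (max_eq_right (by linarith)))

theorem boxFun_of_le {m : ℕ} {i : Lattice N} (h : ‖i‖ ≤ m) : boxFun N q m i = 1 :=
  if_pos h

theorem boxFun_of_lt {m : ℕ} {i : Lattice N} (h : (m : ℝ) < ‖i‖) : boxFun N q m i = 0 :=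
  if_neg h.not_ge

theorem boxFun_nonneg (m : ℕ) (i : Lattice N) : 0 ≤ boxFun N q m i := by
  rcases le_or_gt ‖i‖ m with h | h
  · rw [boxFun_of_le h]
    exact zero_le_one
  · rw [boxFun_of_lt h]

theorem tent_apply (m : ℕ) (i : Lattice N) : tent N q m i = max (2 * m - ‖i‖) 0 := rfl

theorem tent_nonneg (m : ℕ) (i : Lattice N) : 0 ≤ tent N q m i := le_max_right _ _

theorem tent_le (m : ℕ) (i : Lattice N) : tent N q m i ≤ 2 * m := by
  rw [tent_apply]
  exact max_le (by linarith [norm_nonneg i]) (by positivity)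

theorem norm_le_of_tent_ne_zero {m : ℕ} {i : Lattice N} (h : tent N q m i ≠ 0) :
    ‖i‖ ≤ 2 * m := by
  by_contra hi
  push Not at hi
  exact h (max_eq_right (by linarith))

theorem abs_tent_sub_le (m : ℕ) (i j : Lattice N) :
    |tent N q m (i - j) - tent N q m i| ≤ ‖j‖ := by
  rw [tent_apply, tent_apply]
  refine (abs_max_sub_max_le_abs _ _ _).trans ?_
  have h : (2 * (m : ℝ) - ‖i - j‖) - (2 * m - ‖i‖) = ‖i‖ - ‖i - j‖ := by ring
  rw [h]
  simpa using abs_norm_sub_norm_le i (i - j)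

variable [Fact (1 ≤ q)]

theorem norm_mono_mul {ι : Type*} {E F : ι → Type*} [∀ i, NormedAddCommGroup (E i)]
    [∀ i, NormedAddCommGroup (F i)] (x : lp E q) (y : lp F q) {c : ℝ} (hc : 0 ≤ c)
    (h : ∀ i, ‖x i‖ ≤ c * ‖y i‖) : ‖x‖ ≤ c * ‖y‖ := by
  have h1 : ‖x‖ ≤ ‖c • lp.toNorm y‖ := by
    refine lp.norm_mono exponent_ne_zero fun i => (h i).trans ?_
    exact le_abs_self _
  rwa [lp.norm_const_smul exponent_ne_zero, lp.norm_toNorm, Real.norm_of_nonneg hc] at h1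

theorem norm_lpShift {𝕜 X : Type*} [RCLike 𝕜] [NormedAddCommGroup X] [NormedSpace 𝕜 X]
    (α : Lattice N) (x : Seq X N q) : ‖lpShift 𝕜 α x‖ = ‖x‖ := by
  have h1 : ‖lpShift 𝕜 α x‖ ≤ 1 * ‖x‖ := norm_shift_le α x
  rw [one_mul] at h1
  refine le_antisymm h1 ?_
  have h : lpShift 𝕜 (-α) (lpShift 𝕜 α x) = x := by
    ext i
    simp
  have h2 : ‖lpShift 𝕜 (-α) (lpShift 𝕜 α x)‖ ≤ 1 * ‖lpShift 𝕜 α x‖ :=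
    norm_shift_le (-α) (lpShift 𝕜 α x)
  rwa [h, one_mul] at h2

/-- The vectors in `{-1, 0, 1}^N`. -/
def signVectors (N : ℕ) : Finset (Lattice N) := Fintype.piFinset fun _ => {-1, 0, 1}

/-- The cube of radius `3m` is tiled by `3^N` cubes of radius `m`, each of side length `2m + 1` in
lattice points. -/
theorem exists_signVector {m : ℕ} {i : Lattice N} (h : ‖i‖ ≤ (3 * m : ℕ)) :
    ∃ β ∈ signVectors N, ‖i - (2 * m + 1 : ℤ) • β‖ ≤ m := by
  have h1 : ∀ j, |i j| ≤ 3 * m := by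
    intro j
    have := (norm_le_pi_norm i j).trans h
    rw [Int.norm_eq_abs] at this
    exact_mod_cast this
  have h2 : ∀ j, ∃ b : ℤ, b ∈ ({-1, 0, 1} : Finset ℤ) ∧ |i j - (2 * m + 1) * b| ≤ m := by
    intro j
    have h3 := abs_le.1 (h1 j)
    rcases lt_or_ge (i j) (-m) with h4 | h4
    · exact ⟨-1, by simp, abs_le.2 ⟨by linarith, by linarith⟩⟩
    rcases le_or_gt (i j) m with h5 | h5
    · exact ⟨0, by simp, abs_le.2 ⟨by linarith, by linarith⟩⟩
    · exact ⟨1, by simp, abs_le.2 ⟨by linarith, by linarith⟩⟩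
  choose β hβ hβ' using h2
  refine ⟨β, Fintype.mem_piFinset.2 hβ, (pi_norm_le_iff_of_nonneg (by positivity)).2 fun j => ?_⟩
  rw [Int.norm_eq_abs]
  have := hβ' j
  simp only [Pi.sub_apply, Pi.smul_apply, smul_eq_mul]
  exact_mod_cast this

theorem norm_boxFun_le (m : ℕ) :
    ‖boxFun N q (3 * m)‖ ≤ (signVectors N).card * ‖boxFun N q m‖ := by
  have h1 : ‖boxFun N q (3 * m)‖ ≤
      ‖∑ β ∈ signVectors N, lpShift ℝ ((2 * m + 1 : ℤ) • β) (boxFun N q m)‖ := by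
    refine lp.norm_mono exponent_ne_zero fun i => ?_
    have hnn : ∀ β ∈ signVectors N,
        0 ≤ boxFun N q m (i - (2 * m + 1 : ℤ) • β) := fun β _ => boxFun_nonneg _ _
    have h2 : (∑ β ∈ signVectors N, lpShift ℝ ((2 * m + 1 : ℤ) • β) (boxFun N q m)) i
        = ∑ β ∈ signVectors N, boxFun N q m (i - (2 * m + 1 : ℤ) • β) := by
      rw [lp.coeFn_sum, Finset.sum_apply]
      rfl
    rw [h2, Real.norm_of_nonneg (boxFun_nonneg _ _), Real.norm_of_nonneg (Finset.sum_nonneg hnn)]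
    rcases le_or_gt ‖i‖ (3 * m : ℕ) with hi | hi
    · obtain ⟨β, hβ, hβ'⟩ := exists_signVector hi
      rw [boxFun_of_le hi, ← boxFun_of_le (q := q) hβ']
      exact Finset.single_le_sum hnn hβ
    · rw [boxFun_of_lt hi]
      exact Finset.sum_nonneg hnn
  refine h1.trans ((norm_sum_le _ _).trans ?_)
  simp [norm_lpShift]

/-- The difference is at most `‖α‖` pointwise and lives on the cube of radius `3m`, while the tent
is at least `m` on the cube of radius `m`. The tiling compares the two cubes with a factor
independent of `m`, so the relative variation is of order `1/m`. -/
theorem norm_shift_tent_sub_le {m : ℕ} {α : Lattice N} (hα : ‖α‖ ≤ m) :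
    m * ‖lpShift ℝ α (tent N q m) - tent N q m‖ ≤
      ‖α‖ * (signVectors N).card * ‖tent N q m‖ := by
  have h1 : ‖lpShift ℝ α (tent N q m) - tent N q m‖ ≤ ‖α‖ * ‖boxFun N q (3 * m)‖ := by
    refine norm_mono_mul _ _ (norm_nonneg _) fun i => ?_
    change |tent N q m (i - α) - tent N q m i| ≤ _
    rcases le_or_gt ‖i‖ (3 * m : ℕ) with hi | hi
    · rw [boxFun_of_le hi, norm_one, mul_one]
      exact abs_tent_sub_le m i α
    · push_cast at hi
      have h2 : tent N q m i = 0 := by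
        by_contra h
        have := norm_le_of_tent_ne_zero h
        linarith [norm_nonneg α]
      have h3 : tent N q m (i - α) = 0 := by
        by_contra h
        have := norm_le_of_tent_ne_zero h
        linarith [norm_sub_norm_le i α]
      rw [h2, h3, sub_zero, abs_zero]
      positivity
  have h2 : ‖boxFun N q m‖ * m ≤ ‖tent N q m‖ := by
    rcases Nat.eq_zero_or_pos m with rfl | hm
    · simp
    have hm' : (0 : ℝ) < m := by exact_mod_cast hm
    rw [← le_div_iff₀ hm', div_eq_inv_mul]
    refine norm_mono_mul _ _ (by positivity) fun i => ?_
    rw [Real.norm_of_nonneg (boxFun_nonneg _ _), Real.norm_of_nonneg (tent_nonneg _ _),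
      ← div_eq_inv_mul, le_div_iff₀ hm']
    rcases le_or_gt ‖i‖ m with hi | hi
    · rw [boxFun_of_le hi, one_mul, tent_apply]
      exact le_max_of_le_left (by linarith)
    · rw [boxFun_of_lt hi, zero_mul]
      exact tent_nonneg _ _
  calc m * ‖lpShift ℝ α (tent N q m) - tent N q m‖
      ≤ m * (‖α‖ * ((signVectors N).card * ‖boxFun N q m‖)) := by
        gcongr
        exact h1.trans (by gcongr; exact norm_boxFun_le m)
    _ = ‖α‖ * (signVectors N).card * (‖boxFun N q m‖ * m) := by ring
    _ ≤ _ := by gcongr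

theorem norm_tent_pos {m : ℕ} (hm : 0 < m) : 0 < ‖tent N q m‖ := by
  have h := lp.norm_apply_le_norm exponent_ne_zero (tent N q m) 0
  refine lt_of_lt_of_le ?_ h
  have hm' : (0 : ℝ) < m := by exact_mod_cast hm
  rw [tent_apply, norm_zero, sub_zero, max_eq_left (by positivity)]
  exact norm_pos_iff.2 (by positivity)

end Tents

/-! ### Norm identity for the pieces of a vector -/

section Fubini

variable {N : ℕ} {q : ENNReal} [Fact (1 ≤ q)]

/-- If the `k`-th entry of `w` is the norm of `i ↦ f (i - k) x_i`, then the norm of `w` is the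
product of those of `f` and `x`. -/
theorem convolution_norm {X Y : Type*} [NormedAddCommGroup X] [NormedAddCommGroup Y]
    (f : Seq ℝ N q) (x : Seq X N q)
    (w : Lattice N → Seq Y N q) (hw : ∀ k i, ‖w k i‖ = |f (i - k)| * ‖x i‖) :
    ∃ h : Memℓp (fun k => ‖w k‖) q,
      ‖(⟨fun k => ‖w k‖, h⟩ : Seq ℝ N q)‖ = ‖f‖ * ‖x‖ := by
  rcases q.trichotomy with rfl | rfl | hq
  · exact absurd rfl (exponent_ne_zero (q := 0))
  · have h1 : ∀ k, ‖w k‖ ≤ ‖f‖ * ‖x‖ := fun k =>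
      norm_mono_mul _ _ (norm_nonneg _) fun i => by
        rw [hw]
        gcongr
        exact lp.norm_apply_le_norm exponent_ne_zero f (i - k)
    have h : Memℓp (fun k => ‖w k‖) ⊤ := by
      refine memℓp_infty ⟨‖f‖ * ‖x‖, ?_⟩
      rintro _ ⟨k, rfl⟩
      simpa using h1 k
    refine ⟨h, le_antisymm (lp.norm_le_of_forall_le (by positivity) fun k => by
      simpa using h1 k) ?_⟩
    set W : Seq ℝ N ⊤ := ⟨fun k => ‖w k‖, h⟩
    have h2 : ∀ j i, |f j| * ‖x i‖ ≤ ‖W‖ := by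
      intro j i
      -- The translate `k = i - j` puts the value `f j` at the point `i`, so every product `|f j| *
      -- ‖x i‖` occurs.
      have h3 := lp.norm_apply_le_norm exponent_ne_zero (w (i - j)) i
      rw [hw, sub_sub_cancel] at h3
      refine h3.trans ?_
      have h4 := lp.norm_apply_le_norm exponent_ne_zero W (i - j)
      have h5 : ‖W (i - j)‖ = ‖w (i - j)‖ := norm_norm _
      rwa [h5] at h4
    have h6 : ∀ i, ‖f‖ * ‖x i‖ ≤ ‖W‖ := by
      intro i
      have : ‖‖x i‖ • f‖ ≤ ‖W‖ := lp.norm_le_of_forall_le (norm_nonneg _) fun j => by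
        change ‖‖x i‖ * f j‖ ≤ _
        rw [norm_mul, norm_norm, mul_comm]
        exact h2 j i
      rwa [norm_smul, norm_norm, mul_comm] at this
    have : ‖‖f‖ • lp.toNorm x‖ ≤ ‖W‖ := lp.norm_le_of_forall_le (norm_nonneg _) fun i => by
      change ‖‖f‖ * ‖x i‖‖ ≤ _
      rw [norm_mul, norm_norm, norm_norm]
      exact h6 i
    rwa [norm_smul, norm_norm, lp.norm_toNorm] at this
  · have hf := lp.hasSum_norm hq f
    have hx := lp.hasSum_norm hq x
    have hfx := hf.mul hx (hf.summable.mul_of_nonneg hx.summable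
      (fun _ => by positivity) (fun _ => by positivity))
    let e : Lattice N × Lattice N ≃ Lattice N × Lattice N :=
      { toFun := fun z => (z.2 - z.1, z.2)
        invFun := fun z => (z.2 - z.1, z.2)
        left_inv := fun z => by simp
        right_inv := fun z => by simp }
    have h1 := (e.hasSum_iff).2 hfx
    have h2 : HasSum (fun k => ‖w k‖ ^ q.toReal) (‖f‖ ^ q.toReal * ‖x‖ ^ q.toReal) := by
      refine h1.prod_fiberwise fun k => ?_
      have h3 := lp.hasSum_norm hq (w k)
      refine h3.congr_fun ?_
      intro i
      rw [hw, Real.mul_rpow (abs_nonneg _) (norm_nonneg _)]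
      rfl
    have h : Memℓp (fun k => ‖w k‖) q := memℓp_gen (by simpa using h2.summable)
    refine ⟨h, ?_⟩
    have h4 := lp.hasSum_norm hq (⟨fun k => ‖w k‖, h⟩ : Seq ℝ N q)
    have h5 : HasSum (fun k => ‖w k‖ ^ q.toReal)
        (‖(⟨fun k => ‖w k‖, h⟩ : Seq ℝ N q)‖ ^ q.toReal) := by
      simpa using h4
    have h6 := h5.unique h2
    rw [← Real.mul_rpow (norm_nonneg _) (norm_nonneg _)] at h6
    exact (Real.rpow_left_inj (norm_nonneg _) (by positivity) hq.ne').1 h6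

end Fubini

/-! ### Localization of almost minimizers -/

section Operators

variable {𝕜 : Type*} [RCLike 𝕜] {X : Type*} [NormedAddCommGroup X] [NormedSpace 𝕜 X]
variable {N : ℕ} {p : ENNReal} [Fact (p = 0 ∨ 1 ≤ p)]

theorem SeqSpace.ext {x y : SeqSpace 𝕜 X N p} (h : ∀ i, x.1 i = y.1 i) : x = y :=
  Subtype.ext (lp.ext (funext h))

theorem SeqSpace.exists_ne_zero {x : SeqSpace 𝕜 X N p} (hx : x ≠ 0) : ∃ i, x.1 i ≠ 0 := by
  by_contra! h
  exact hx (SeqSpace.ext h)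

theorem SeqSpace.norm_apply_le (x : SeqSpace 𝕜 X N p) (i : Lattice N) : ‖x.1 i‖ ≤ ‖x‖ :=
  lp.norm_apply_le_norm exponent_ne_zero x.1 i

theorem SeqSpace.norm_le_mul {x y : SeqSpace 𝕜 X N p} {c : ℝ} (hc : 0 ≤ c)
    (h : ∀ i, ‖x.1 i‖ ≤ c * ‖y.1 i‖) : ‖x‖ ≤ c * ‖y‖ :=
  norm_mono_mul x.1 y.1 hc h

theorem norm_shift_apply (α : Lattice N) (x : SeqSpace 𝕜 X N p) :
    ‖shift 𝕜 X p α x‖ = ‖x‖ :=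
  norm_lpShift (𝕜 := 𝕜) α x.1

theorem norm_shift_le_one (α : Lattice N) : ‖shift 𝕜 X (N := N) p α‖ ≤ 1 :=
  ContinuousLinearMap.opNorm_le_bound _ zero_le_one fun x => by
    rw [norm_shift_apply, one_mul]

theorem shift_neg_shift (α : Lattice N) (x : SeqSpace 𝕜 X N p) :
    shift 𝕜 X p (-α) (shift 𝕜 X p α x) = x :=
  SeqSpace.ext fun i => by simp [shift_apply]

theorem shift_shift_neg (α : Lattice N) (x : SeqSpace 𝕜 X N p) :
    shift 𝕜 X p α (shift 𝕜 X p (-α) x) = x :=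
  SeqSpace.ext fun i => by simp [shift_apply]

theorem norm_mulOp_apply_le (a : lp (fun _ : Lattice N => X →L[𝕜] X) ⊤)
    (x : SeqSpace 𝕜 X N p) : ‖mulOp p a x‖ ≤ ‖a‖ * ‖x‖ :=
  SeqSpace.norm_le_mul (norm_nonneg _) fun i =>
    (ContinuousLinearMap.le_opNorm _ _).trans
      (mul_le_mul_of_nonneg_right (lp.norm_apply_le_norm ENNReal.top_ne_zero a i) (norm_nonneg _))

variable (𝕜 X p) in
/-- Multiplication by a bounded scalar function. -/
def scalarOp {q : ENNReal} (f : Seq ℝ N q) : SeqSpace 𝕜 X N p →L[𝕜] SeqSpace 𝕜 X N p :=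
  mulOp p ⟨fun i => (f i : 𝕜) • ContinuousLinearMap.id 𝕜 X, by
    obtain ⟨C, hC⟩ := ((lp.memℓp f).of_exponent_ge le_top).bddAbove
    refine memℓp_infty ⟨C, ?_⟩
    rintro _ ⟨i, rfl⟩
    refine (norm_smul_le (f i : 𝕜) (ContinuousLinearMap.id 𝕜 X)).trans ?_
    have h1 : ‖(f i : 𝕜)‖ ≤ C := by
      rw [RCLike.norm_ofReal]
      exact hC ⟨i, rfl⟩
    calc ‖(f i : 𝕜)‖ * ‖ContinuousLinearMap.id 𝕜 X‖ ≤ ‖(f i : 𝕜)‖ * 1 := by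
          gcongr
          exact ContinuousLinearMap.norm_id_le
      _ ≤ C := by rwa [mul_one]⟩

section scalarOp

variable {q : ENNReal}

theorem scalarOp_apply (f : Seq ℝ N q) (x : SeqSpace 𝕜 X N p) (i : Lattice N) :
    (scalarOp 𝕜 X p f x).1 i = (f i : 𝕜) • x.1 i := rfl

theorem norm_scalarOp_apply (f : Seq ℝ N q) (x : SeqSpace 𝕜 X N p) (i : Lattice N) :
    ‖(scalarOp 𝕜 X p f x).1 i‖ = |f i| * ‖x.1 i‖ := by
  rw [scalarOp_apply, norm_smul, RCLike.norm_ofReal]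

theorem norm_scalarOp_le (f : Seq ℝ N q) {c : ℝ} (h : ∀ i, |f i| ≤ c) :
    ‖scalarOp 𝕜 X p f‖ ≤ c := by
  have hc : 0 ≤ c := (abs_nonneg _).trans (h 0)
  refine ContinuousLinearMap.opNorm_le_bound _ hc fun x => SeqSpace.norm_le_mul hc fun i => ?_
  rw [norm_scalarOp_apply]
  gcongr
  exact h i

/-- Scalar functions commute with operator-valued multiplications, so only moving `f` past the shift
contributes. -/
theorem mulOp_shift_commutator [Fact (1 ≤ q)] (a : lp (fun _ : Lattice N => X →L[𝕜] X) ⊤)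
    (α : Lattice N) (f : Seq ℝ N q) :
    mulOp p a * shift 𝕜 X p α * scalarOp 𝕜 X p f - scalarOp 𝕜 X p f * (mulOp p a * shift 𝕜 X p α)
      = mulOp p a * scalarOp 𝕜 X p (lpShift ℝ α f - f) * shift 𝕜 X p α := by
  ext x
  refine SeqSpace.ext fun i => ?_
  have h : ((lpShift ℝ α f - f : Seq ℝ N q)) i = f (i - α) - f i := rfl
  change a i ((f (i - α) : 𝕜) • x.1 (i - α)) - (f i : 𝕜) • a i (x.1 (i - α))
    = a i (((lpShift ℝ α f - f : Seq ℝ N q) i : 𝕜) • x.1 (i - α))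
  rw [h, map_smul, map_smul, RCLike.ofReal_sub, sub_smul]

end scalarOp

/-- The norms of the pieces `f(· - k) x`. -/
theorem pieces_norm (f : Seq ℝ N (normExponent p)) (x : SeqSpace 𝕜 X N p) :
    ∃ h : Memℓp (fun k => ‖scalarOp 𝕜 X p (lpShift ℝ k f) x‖) (normExponent p),
      ‖(⟨fun k => ‖scalarOp 𝕜 X p (lpShift ℝ k f) x‖, h⟩ : Seq ℝ N (normExponent p))‖
        = ‖f‖ * ‖x‖ :=
  convolution_norm f x.1 (fun k => (scalarOp 𝕜 X p (lpShift ℝ k f) x).1) fun k i => by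
    rw [norm_scalarOp_apply, lpShift_apply]

/-- The sequence of the norms of the pieces `f(· - k) x`. -/
def pieces (f : Seq ℝ N (normExponent p)) (x : SeqSpace 𝕜 X N p) : Seq ℝ N (normExponent p) :=
  ⟨fun k => ‖scalarOp 𝕜 X p (lpShift ℝ k f) x‖, (pieces_norm f x).1⟩

theorem pieces_apply (f : Seq ℝ N (normExponent p)) (x : SeqSpace 𝕜 X N p) (k : Lattice N) :
    pieces f x k = ‖scalarOp 𝕜 X p (lpShift ℝ k f) x‖ := rfl

theorem norm_pieces (f : Seq ℝ N (normExponent p)) (x : SeqSpace 𝕜 X N p) :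
    ‖pieces f x‖ = ‖f‖ * ‖x‖ := (pieces_norm f x).2

/-- Makes the commutator with the `k`-th translate of `f` the `k`-th piece for the single function
`f(· - α) - f`, so that the norm identity also applies to the error terms. -/
theorem lpShift_comm {q : ENNReal} [Fact (1 ≤ q)] (α β : Lattice N) (f : Seq ℝ N q) :
    lpShift ℝ α (lpShift ℝ β f) - lpShift ℝ β f = lpShift ℝ β (lpShift ℝ α f - f) := by
  ext i
  change f (i - α - β) - f (i - β) = f (i - β - α) - f (i - β)
  rw [sub_right_comm]

/-- A band operator almost commutes with a slowly varying function. -/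
theorem band_piece_le (S : Finset (Lattice N))
    (a : Lattice N → lp (fun _ : Lattice N => X →L[𝕜] X) ⊤)
    (f : Seq ℝ N (normExponent p)) (x : SeqSpace 𝕜 X N p) (k : Lattice N) :
    ‖(∑ α ∈ S, mulOp p (a α) * shift 𝕜 X p α) (scalarOp 𝕜 X p (lpShift ℝ k f) x)‖ ≤
      pieces f ((∑ α ∈ S, mulOp p (a α) * shift 𝕜 X p α) x) k +
        ∑ α ∈ S, ‖a α‖ * pieces (lpShift ℝ α f - f) (shift 𝕜 X p α x) k := by
  set F := scalarOp 𝕜 X p (lpShift ℝ k f)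
  have h1 : (∑ α ∈ S, mulOp p (a α) * shift 𝕜 X p α) (F x)
      = F ((∑ α ∈ S, mulOp p (a α) * shift 𝕜 X p α) x) +
        ∑ α ∈ S, mulOp p (a α)
          (scalarOp 𝕜 X p (lpShift ℝ k (lpShift ℝ α f - f)) (shift 𝕜 X p α x)) := by
    rw [← sub_eq_iff_eq_add', sum_apply, sum_apply,
      map_sum, ← Finset.sum_sub_distrib]
    refine Finset.sum_congr rfl fun α _ => ?_
    have h2 := congrArg (fun T => T x) (mulOp_shift_commutator (p := p) (a α) α (lpShift ℝ k f))
    rw [lpShift_comm] at h2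
    exact h2
  rw [h1]
  refine (norm_add_le _ _).trans (add_le_add le_rfl ((norm_sum_le _ _).trans ?_))
  exact Finset.sum_le_sum fun α _ => norm_mulOp_apply_le _ _

theorem norm_shift_tent_tendsto (α : Lattice N) {q : ENNReal} [Fact (1 ≤ q)] {ε : ℝ}
    (hε : 0 < ε) :
    ∀ᶠ m : ℕ in atTop, ‖lpShift ℝ α (tent N q m) - tent N q m‖ ≤ ε * ‖tent N q m‖ := by
  have h1 := tendsto_natCast_atTop_atTop (R := ℝ)
  filter_upwards [h1.eventually_ge_atTop ‖α‖, eventually_gt_atTop 0,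
    h1.eventually_ge_atTop (‖α‖ * (signVectors N).card / ε)] with m h2 h3 h4
  have h3' : (0 : ℝ) < m := by exact_mod_cast h3
  rw [div_le_iff₀ hε] at h4
  have h5 := norm_shift_tent_sub_le (q := q) h2
  refine le_of_mul_le_mul_left (h5.trans ?_) h3'
  rw [← mul_assoc]
  gcongr

theorem scalarOp_tent_support {m : ℕ} {k i : Lattice N} {x : SeqSpace 𝕜 X N p} {q : ENNReal}
    [Fact (1 ≤ q)] (h : (scalarOp 𝕜 X p (lpShift ℝ k (tent N q m)) x).1 i ≠ 0) :
    x.1 i ≠ 0 ∧ ‖i - k‖ ≤ 2 * m := by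
  rw [scalarOp_apply, lpShift_apply] at h
  refine ⟨right_ne_zero_of_smul h, norm_le_of_tent_ne_zero (q := q) fun h0 => h ?_⟩
  rw [h0, RCLike.ofReal_zero, zero_smul]

/-- Localization for band operators. -/
theorem IsBand.localization {A : SeqSpace 𝕜 X N p →L[𝕜] SeqSpace 𝕜 X N p} (hA : IsBand A)
    {ε : ℝ} (hε : 0 < ε) :
    ∃ r : ℝ, ∀ (x : SeqSpace 𝕜 X N p) (c : ℝ), x ≠ 0 → ‖A x‖ ≤ c * ‖x‖ →
      ∃ y : SeqSpace 𝕜 X N p, y ≠ 0 ∧ ‖A y‖ ≤ (c + ε) * ‖y‖ ∧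
        ∃ k, ∀ i, y.1 i ≠ 0 → x.1 i ≠ 0 ∧ ‖i - k‖ ≤ r := by
  obtain ⟨S, a, rfl⟩ := hA
  -- The summand `1` keeps `M` positive when all coefficients vanish; tolerance `ε / (2 * M)` per
  -- diagonal makes the total error at most `ε / 2`.
  set M : ℝ := ∑ α ∈ S, ‖a α‖ + 1
  have hM : 0 < M := by positivity
  have hev : ∀ᶠ m : ℕ in atTop, ∀ α ∈ S,
      ‖lpShift ℝ α (tent N (normExponent p) m) - tent N (normExponent p) m‖ ≤
        ε / (2 * M) * ‖tent N (normExponent p) m‖ :=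
    (Finset.eventually_all S).2 fun α _ => norm_shift_tent_tendsto α (by positivity)
  obtain ⟨m, hm, hm0⟩ := (hev.and (eventually_gt_atTop 0)).exists
  set t := tent N (normExponent p) m
  have ht : 0 < ‖t‖ := norm_tent_pos hm0
  refine ⟨2 * m, fun x c hx hxc => ?_⟩
  set B := ∑ α ∈ S, mulOp p (a α) * shift 𝕜 X p α
  have hx' : 0 < ‖x‖ := norm_pos_iff.2 hx
  have hc : 0 ≤ c := nonneg_of_mul_nonneg_left ((norm_nonneg _).trans hxc) hx'
  by_contra! hcon
  -- If every nonzero piece fails, this holds for all `k`; taking norms gives `c + ε ≤ c + ε / 2`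
  -- after division by `‖t‖ * ‖x‖`.
  have key : ∀ k, (c + ε) * pieces t x k ≤
      (pieces t (B x) + ∑ α ∈ S, ‖a α‖ • pieces (lpShift ℝ α t - t) (shift 𝕜 X p α x)) k := by
    intro k
    have h1 : (pieces t (B x) +
        ∑ α ∈ S, ‖a α‖ • pieces (lpShift ℝ α t - t) (shift 𝕜 X p α x)) k
        = pieces t (B x) k + ∑ α ∈ S, ‖a α‖ * pieces (lpShift ℝ α t - t) (shift 𝕜 X p α x) k := by
      rw [lp.coeFn_add, Pi.add_apply, lp.coeFn_sum, Finset.sum_apply]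
      rfl
    rw [h1]
    refine le_trans ?_ (band_piece_le S a t x k)
    rw [pieces_apply]
    by_cases hy : scalarOp 𝕜 X p (lpShift ℝ k t) x = 0
    · rw [hy, norm_zero, mul_zero]
      exact norm_nonneg _
    · by_contra! hlt
      obtain ⟨i, hi1, hi2⟩ := hcon _ hy hlt.le k
      exact absurd (scalarOp_tent_support hi1).2 (hi2 (scalarOp_tent_support hi1).1).not_ge
  have h2 : ‖(c + ε) • pieces t x‖ ≤
      ‖pieces t (B x) + ∑ α ∈ S, ‖a α‖ • pieces (lpShift ℝ α t - t) (shift 𝕜 X p α x)‖ := by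
    refine lp.norm_mono exponent_ne_zero fun k => ?_
    have h3 : ‖((c + ε) • pieces t x) k‖ = (c + ε) * pieces t x k :=
      Real.norm_of_nonneg (mul_nonneg (by positivity) (norm_nonneg _))
    rw [h3]
    exact (key k).trans (le_abs_self _)
  rw [norm_smul, Real.norm_of_nonneg (by positivity), norm_pieces] at h2
  have h4 : ‖pieces t (B x) + ∑ α ∈ S, ‖a α‖ • pieces (lpShift ℝ α t - t) (shift 𝕜 X p α x)‖ ≤
      ‖t‖ * (c * ‖x‖) + ∑ α ∈ S, ‖a α‖ * (ε / (2 * M) * ‖t‖ * ‖x‖) := by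
    refine (norm_add_le _ _).trans (add_le_add ?_ ((norm_sum_le _ _).trans ?_))
    · rw [norm_pieces]
      gcongr
    · refine Finset.sum_le_sum fun α hα => ?_
      rw [norm_smul, norm_norm, norm_pieces, norm_shift_apply]
      gcongr
      exact hm α hα
  have h5 : ∑ α ∈ S, ‖a α‖ * (ε / (2 * M) * ‖t‖ * ‖x‖) ≤ M * (ε / (2 * M) * ‖t‖ * ‖x‖) := by
    rw [← Finset.sum_mul]
    gcongr
    exact (lt_add_one _).le
  have h6 : M * (ε / (2 * M) * ‖t‖ * ‖x‖) = ε / 2 * (‖t‖ * ‖x‖) := by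
    field_simp
  have h7 : 0 < ε * (‖t‖ * ‖x‖) := by positivity
  nlinarith

/-- A third of `ε` is spent on each of: passing from `A` to a nearby band operator, localizing
there, and returning to `A`. -/
theorem IsBandDominated.localization {A : SeqSpace 𝕜 X N p →L[𝕜] SeqSpace 𝕜 X N p}
    (hA : IsBandDominated A) {ε : ℝ} (hε : 0 < ε) :
    ∃ r : ℝ, ∀ (x : SeqSpace 𝕜 X N p) (c : ℝ), x ≠ 0 → ‖A x‖ ≤ c * ‖x‖ →
      ∃ y : SeqSpace 𝕜 X N p, y ≠ 0 ∧ ‖A y‖ ≤ (c + ε) * ‖y‖ ∧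
        ∃ k, ∀ i, y.1 i ≠ 0 → x.1 i ≠ 0 ∧ ‖i - k‖ ≤ r := by
  obtain ⟨B, hB, hAB⟩ := Metric.mem_closure_iff.1 hA (ε / 3) (by positivity)
  rw [dist_eq_norm] at hAB
  have hpert : ∀ z : SeqSpace 𝕜 X N p, ‖A z - B z‖ ≤ ε / 3 * ‖z‖ := fun z =>
    ((A - B).le_opNorm z).trans (by gcongr)
  obtain ⟨r, hr⟩ := IsBand.localization hB (ε := ε / 3) (by positivity)
  refine ⟨r, fun x c hx hxc => ?_⟩
  obtain ⟨y, hy, hBy, hk⟩ := hr x (c + ε / 3) hx (by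
    have := norm_sub_norm_le (B x) (A x)
    rw [norm_sub_rev] at this
    linarith [hpert x])
  refine ⟨y, hy, ?_, hk⟩
  linarith [norm_sub_norm_le (A y) (B y), hpert y]

/-- The shrinking chain of almost minimizers around a common point. -/
theorem IsBandDominated.nested_localization {A : SeqSpace 𝕜 X N p →L[𝕜] SeqSpace 𝕜 X N p}
    (hA : IsBandDominated A) :
    ∃ r : ℕ → ℝ, ∀ (n : ℕ) (x : SeqSpace 𝕜 X N p) (c : ℝ), x ≠ 0 → ‖A x‖ ≤ c * ‖x‖ →
      ∃ h, x.1 h ≠ 0 ∧ ∀ j ≤ n, ∃ z : SeqSpace 𝕜 X N p, z ≠ 0 ∧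
        ‖A z‖ ≤ (c + (2 * (1 / 2) ^ j - (1 / 2) ^ n)) * ‖z‖ ∧
          ∀ i, z.1 i ≠ 0 → ‖i - h‖ ≤ r j := by
  have hloc : ∀ j : ℕ, _ := fun j => hA.localization (ε := (1 / 2) ^ j) (by positivity)
  choose r hr using hloc
  -- Recentring a ball at a point of the support doubles the radius.
  have hdiam : ∀ {j : ℕ} {y : SeqSpace 𝕜 X N p} {P : Lattice N → Prop} {k h : Lattice N},
      (∀ i, y.1 i ≠ 0 → P i ∧ ‖i - k‖ ≤ r j) → y.1 h ≠ 0 →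
        ∀ i, y.1 i ≠ 0 → ‖i - h‖ ≤ 2 * r j := by
    intro j y P k h hk hh i hi
    have h1 := norm_sub_le_norm_sub_add_norm_sub i k h
    rw [norm_sub_rev k h] at h1
    linarith [(hk i hi).2, (hk h hh).2]
  refine ⟨fun j => 2 * r j, fun n => ?_⟩
  induction n with
  | zero =>
    intro x c hx hxc
    obtain ⟨y, hy, hAy, k, hk⟩ := hr 0 x c hx hxc
    obtain ⟨h, hh⟩ := SeqSpace.exists_ne_zero hy
    refine ⟨h, (hk h hh).1, fun j hj => ⟨y, hy, ?_, ?_⟩⟩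
    · obtain rfl := Nat.le_zero.1 hj
      norm_num at hAy ⊢
      exact hAy
    · obtain rfl := Nat.le_zero.1 hj
      exact hdiam hk hh
  | succ n ih =>
    intro x c hx hxc
    -- The finest tolerance comes first, and the shorter chain is built inside the support of `y`;
    -- its common point then also lies in that support.
    obtain ⟨y, hy, hAy, k, hk⟩ := hr (n + 1) x c hx hxc
    obtain ⟨h, hh, hz⟩ := ih y _ hy hAy
    refine ⟨h, (hk h hh).1, fun j hj => ?_⟩
    rcases Nat.le_add_one_iff.1 hj with hj | rfl
    · obtain ⟨z, hz0, hAz, hsupp⟩ := hz j hj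
      refine ⟨z, hz0, hAz.trans_eq ?_, hsupp⟩
      ring
    · refine ⟨y, hy, hAy.trans_eq ?_, hdiam hk hh⟩
      ring

end Operators

/-! ### Convergence of the translates, entrywise and on bounded supports -/

section LimitOperators

variable {𝕜 : Type*} [RCLike 𝕜] {X : Type*} [NormedAddCommGroup X] [NormedSpace 𝕜 X]
variable {N : ℕ} {p : ENNReal} [Fact (p = 0 ∨ 1 ≤ p)]

theorem norm_le_natCast_iff {n : ℕ} {i : Lattice N} :
    ‖i‖ ≤ n ↔ ∀ j, -(n : ℤ) ≤ i j ∧ i j ≤ n := by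
  rw [pi_norm_le_iff_of_nonneg (by positivity)]
  refine forall_congr' fun j => ?_
  rw [Int.norm_eq_abs, ← abs_le]
  exact_mod_cast Iff.rfl

theorem mem_cube_iff {n : ℕ} {i : Lattice N} :
    i ∈ {i : Lattice N | ∀ j, -(n : ℤ) ≤ i j ∧ i j ≤ n} ↔ ‖i‖ ≤ n := by
  rw [Set.mem_ofPred_eq, norm_le_natCast_iff]

theorem proj_apply_of_le {n : ℕ} {i : Lattice N} (h : ‖i‖ ≤ n) (x : SeqSpace 𝕜 X N p) :
    (proj 𝕜 X N p n x).1 i = x.1 i := by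
  have h1 : charFun 𝕜 X {i : Lattice N | ∀ j, -(n : ℤ) ≤ i j ∧ i j ≤ n} i
      = ContinuousLinearMap.id 𝕜 X := Set.indicator_of_mem (mem_cube_iff.2 h) fun _ => ContinuousLinearMap.id 𝕜 X
  rw [proj, mulOp_apply, h1, ContinuousLinearMap.id_apply]

theorem proj_apply_of_lt {n : ℕ} {i : Lattice N} (h : (n : ℝ) < ‖i‖) (x : SeqSpace 𝕜 X N p) :
    (proj 𝕜 X N p n x).1 i = 0 := by
  have h1 : charFun 𝕜 X {i : Lattice N | ∀ j, -(n : ℤ) ≤ i j ∧ i j ≤ n} i = 0 :=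
    Set.indicator_of_notMem (fun h2 => h.not_ge (mem_cube_iff.1 h2))
      fun _ => ContinuousLinearMap.id 𝕜 X
  rw [proj, mulOp_apply, h1, zero_apply]

theorem proj_eq_self {n : ℕ} {x : SeqSpace 𝕜 X N p} (h : ∀ i, x.1 i ≠ 0 → ‖i‖ ≤ n) :
    proj 𝕜 X N p n x = x := by
  refine SeqSpace.ext fun i => ?_
  rcases le_or_gt ‖i‖ n with hi | hi
  · exact proj_apply_of_le hi x
  · rw [proj_apply_of_lt hi]
    by_contra h0
    exact hi.not_ge (h i (Ne.symm h0))

variable {T : ℕ → SeqSpace 𝕜 X N p →L[𝕜] SeqSpace 𝕜 X N p}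
  {A B : SeqSpace 𝕜 X N p →L[𝕜] SeqSpace 𝕜 X N p}

theorem PTendsto.tendsto_apply (h : PTendsto T B) (x : SeqSpace 𝕜 X N p) (i : Lattice N) :
    Tendsto (fun n => (T n x).1 i) atTop (𝓝 ((B x).1 i)) := by
  obtain ⟨m, hm⟩ := exists_nat_ge ‖i‖
  rw [tendsto_iff_norm_sub_tendsto_zero]
  have h1 := (h.2.2 m).mul_const ‖x‖
  rw [zero_mul] at h1
  refine squeeze_zero (fun _ => norm_nonneg _) (fun n => ?_) h1
  have h2 := SeqSpace.norm_apply_le ((proj 𝕜 X N p m * (T n - B)) x) i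
  have h3 : ((proj 𝕜 X N p m * (T n - B)) x).1 i = (T n x).1 i - (B x).1 i :=
    proj_apply_of_le hm _
  rw [h3] at h2
  refine (h2.trans (ContinuousLinearMap.le_opNorm _ _)).trans ?_
  gcongr
  exact le_add_of_nonneg_right (norm_nonneg _)

theorem PTendsto.tendsto_norm_sub_mul_proj (h : PTendsto T B) (m : ℕ) :
    Tendsto (fun n => ‖(T n - B) * proj 𝕜 X N p m‖) atTop (𝓝 0) :=
  squeeze_zero (fun _ => norm_nonneg _) (fun _ => le_add_of_nonneg_left (norm_nonneg _))
    (h.2.2 m)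

theorem norm_sub_apply_le_of_support {m : ℕ} {x : SeqSpace 𝕜 X N p}
    (h : ∀ i, x.1 i ≠ 0 → ‖i‖ ≤ m) :
    ‖A x - B x‖ ≤ ‖(A - B) * proj 𝕜 X N p m‖ * ‖x‖ := by
  have h1 := ((A - B) * proj 𝕜 X N p m).le_opNorm x
  rwa [mul_apply_eq_comp, proj_eq_self h] at h1

/-- Lower semicontinuity of the norm replaces norm convergence, which fails for truncations when `p
= ∞`. -/
theorem SeqSpace.norm_le_of_tendsto {x : ℕ → SeqSpace 𝕜 X N p} {y : SeqSpace 𝕜 X N p} {c : ℝ}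
    (h : ∀ᶠ n in atTop, ‖x n‖ ≤ c)
    (hx : ∀ i, Tendsto (fun n => (x n).1 i) atTop (𝓝 (y.1 i))) : ‖y‖ ≤ c :=
  lp.norm_le_of_tendsto (F := fun n => (x n).1) h (tendsto_pi_nhds.2 hx)

/-! ### Commutators with tents and bounded supports -/

theorem norm_commutator_le (A F : SeqSpace 𝕜 X N p →L[𝕜] SeqSpace 𝕜 X N p) :
    ‖A * F - F * A‖ ≤ 2 * (‖A‖ * ‖F‖) := by
  refine (norm_sub_le _ _).trans ?_
  linarith [norm_mul_le A F, norm_mul_le F A, mul_comm ‖F‖ ‖A‖]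

theorem norm_scalarOp_tent_le (m : ℕ) (k : Lattice N) :
    ‖scalarOp 𝕜 X p (lpShift ℝ k (tent N (normExponent p) m))‖ ≤ 2 * m :=
  norm_scalarOp_le _ fun i => by
    rw [lpShift_apply, abs_of_nonneg (tent_nonneg _ _)]
    exact tent_le _ _

/-- Tents are 1-Lipschitz for every `m`, so the commutator stays bounded while the height `2m`
grows. -/
theorem IsBand.norm_commutator_tent_le (hA : IsBand A) :
    ∃ c : ℝ, ∀ m k, ‖A * scalarOp 𝕜 X p (lpShift ℝ k (tent N (normExponent p) m)) -
      scalarOp 𝕜 X p (lpShift ℝ k (tent N (normExponent p) m)) * A‖ ≤ c := by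
  obtain ⟨S, a, rfl⟩ := hA
  refine ⟨∑ α ∈ S, ‖a α‖ * ‖α‖, fun m k => ?_⟩
  rw [Finset.sum_mul, Finset.mul_sum, ← Finset.sum_sub_distrib]
  refine (norm_sum_le _ _).trans (Finset.sum_le_sum fun α _ => ?_)
  rw [mulOp_shift_commutator, lpShift_comm]
  have h1 : ‖mulOp (N := N) p (a α)‖ ≤ ‖a α‖ :=
    ContinuousLinearMap.opNorm_le_bound _ (norm_nonneg _) (norm_mulOp_apply_le _)
  have h2 : ‖scalarOp 𝕜 X p (lpShift ℝ k
      (lpShift ℝ α (tent N (normExponent p) m) - tent N (normExponent p) m))‖ ≤ ‖α‖ :=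
    norm_scalarOp_le _ fun i => abs_tent_sub_le m (i - k) α
  calc _ ≤ ‖mulOp (N := N) p (a α)‖ * ‖scalarOp 𝕜 X p (lpShift ℝ k
      (lpShift ℝ α (tent N (normExponent p) m) - tent N (normExponent p) m))‖ *
        ‖shift 𝕜 X (N := N) p α‖ :=
        (norm_mul_le _ _).trans (by gcongr; exact norm_mul_le _ _)
    _ ≤ ‖a α‖ * ‖α‖ * 1 := by
        gcongr
        exact norm_shift_le_one α
    _ = _ := mul_one _

theorem IsBandDominated.norm_commutator_tent_le (hA : IsBandDominated A) {ε : ℝ} (hε : 0 < ε) :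
    ∀ᶠ m : ℕ in atTop, ∀ k,
      ‖A * scalarOp 𝕜 X p (lpShift ℝ k (tent N (normExponent p) m)) -
        scalarOp 𝕜 X p (lpShift ℝ k (tent N (normExponent p) m)) * A‖ ≤ 2 * m * ε := by
  obtain ⟨D, hD, hAD⟩ := Metric.mem_closure_iff.1 hA (ε / 4) (by positivity)
  rw [dist_eq_norm] at hAD
  obtain ⟨c, hc⟩ := IsBand.norm_commutator_tent_le hD
  filter_upwards [tendsto_natCast_atTop_atTop.eventually_ge_atTop (c / ε)] with m hm k
  rw [div_le_iff₀ hε] at hm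
  set F := scalarOp 𝕜 X p (lpShift ℝ k (tent N (normExponent p) m))
  have h1 : A * F - F * A = ((A - D) * F - F * (A - D)) + (D * F - F * D) := by noncomm_ring
  have h2 : ‖A - D‖ * ‖F‖ ≤ ε / 4 * (2 * m) :=
    mul_le_mul hAD.le (norm_scalarOp_tent_le m k) (norm_nonneg _) (by positivity)
  rw [h1]
  refine (norm_add_le _ _).trans ?_
  linarith [norm_commutator_le (A - D) F, hc m k]

theorem shift_scalarOp {q : ENNReal} [Fact (1 ≤ q)] (f : Seq ℝ N q) (h : Lattice N)
    (x : SeqSpace 𝕜 X N p) :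
    shift 𝕜 X p h (scalarOp 𝕜 X p f x) = scalarOp 𝕜 X p (lpShift ℝ h f) (shift 𝕜 X p h x) :=
  SeqSpace.ext fun _ => rfl

/-- Limit operators inherit the commutator estimates. -/
theorem IsLimitOperator.norm_commutator_tent_le (hA : IsBandDominated A) {h : ℕ → Lattice N}
    (hB : IsLimitOperator A h B) {ε : ℝ} (hε : 0 < ε) :
    ∀ᶠ m : ℕ in atTop, ∀ x,
      ‖B (scalarOp 𝕜 X p (tent N (normExponent p) m) x) -
        scalarOp 𝕜 X p (tent N (normExponent p) m) (B x)‖ ≤ 2 * m * ε * ‖x‖ := by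
  filter_upwards [hA.norm_commutator_tent_le hε] with m hm x
  set t := tent N (normExponent p) m
  let W : ℕ → SeqSpace 𝕜 X N p →L[𝕜] SeqSpace 𝕜 X N p :=
    fun n => shift 𝕜 X p (-h n) * A * shift 𝕜 X p (h n)
  have hW : PTendsto W B := hB
  -- The commutator of `B` is the entrywise limit of shifted commutators of `A` with the tent moved
  -- to `h n`; this is why the bound for `A` must be uniform in `k`.
  refine SeqSpace.norm_le_of_tendsto
    (x := fun n => W n (scalarOp 𝕜 X p t x) - scalarOp 𝕜 X p t (W n x))
    (Eventually.of_forall fun n => ?_) fun i => ?_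
  · set F := scalarOp 𝕜 X p (lpShift ℝ (h n) t)
    have h1 : W n (scalarOp 𝕜 X p t x) - scalarOp 𝕜 X p t (W n x)
        = shift 𝕜 X p (-h n) ((A * F - F * A) (shift 𝕜 X p (h n) x)) := by
      have h2 : scalarOp 𝕜 X p t (W n x)
          = shift 𝕜 X p (-h n) (F (A (shift 𝕜 X p (h n) x))) := by
        have h3 := congrArg (shift 𝕜 X p (-h n)) (shift_scalarOp t (h n) (W n x))
        rw [shift_neg_shift] at h3
        rw [h3]
        change shift 𝕜 X p (-h n) (F (shift 𝕜 X p (h n) (shift 𝕜 X p (-h n) _))) = _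
        rw [shift_shift_neg]
        rfl
      have h4 : W n (scalarOp 𝕜 X p t x)
          = shift 𝕜 X p (-h n) (A (F (shift 𝕜 X p (h n) x))) := by
        rw [← shift_scalarOp]
        rfl
      rw [h2, h4, ← map_sub]
      rfl
    rw [h1, norm_shift_apply]
    refine (ContinuousLinearMap.le_opNorm _ _).trans ?_
    rw [norm_shift_apply]
    gcongr
    exact hm (h n)
  · exact (hW.tendsto_apply _ i).sub ((hW.tendsto_apply x i).const_smul (t i : 𝕜))

/-- The normalized tents `t / (2m)` tend to `1` pointwise, so by lower semicontinuity they cannot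
eventually shrink `x` by a fixed factor. -/
theorem frequently_norm_tent_ge (x : SeqSpace 𝕜 X N p) (hx : x ≠ 0) {δ : ℝ} (hδ : 0 < δ) :
    ∃ᶠ m : ℕ in atTop,
      2 * m * ((1 - δ) * ‖x‖) < ‖scalarOp 𝕜 X p (tent N (normExponent p) m) x‖ := by
  by_contra hcon
  rw [not_frequently] at hcon
  have hx' : 0 < ‖x‖ := norm_pos_iff.2 hx
  have h1 : ‖x‖ ≤ (1 - δ) * ‖x‖ := by
    refine SeqSpace.norm_le_of_tendsto (x := fun m : ℕ => ((2 * m : ℝ)⁻¹ : 𝕜) •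
      scalarOp 𝕜 X p (tent N (normExponent p) m) x) ?_ fun i => ?_
    · filter_upwards [hcon, eventually_gt_atTop 0] with m hm hm0
      have hm0' : (0 : ℝ) < m := by exact_mod_cast hm0
      rw [not_lt] at hm
      rw [norm_smul]
      have h2 : ‖((2 * m : ℝ)⁻¹ : 𝕜)‖ = (2 * m : ℝ)⁻¹ := by
        norm_num
      rw [h2, inv_mul_le_iff₀ (by positivity)]
      exact hm
    · have h3 : Tendsto (fun m : ℕ => 1 - ‖i‖ / 2 * (m : ℝ)⁻¹) atTop (𝓝 1) := by
        simpa using (tendsto_inv_atTop_nhds_zero_nat (𝕜 := ℝ)).const_mul (‖i‖ / 2) |>.const_sub 1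
      have h4 := ((RCLike.continuous_ofReal (K := 𝕜)).tendsto 1).comp h3
      have h5 := h4.smul_const (x.1 i)
      rw [RCLike.ofReal_one, one_smul] at h5
      refine h5.congr' ?_
      filter_upwards [eventually_gt_atTop 0,
        tendsto_natCast_atTop_atTop.eventually_ge_atTop ‖i‖] with m hm0 hm
      have hm0' : (m : ℝ) ≠ 0 := by exact_mod_cast hm0.ne'
      have h6 : tent N (normExponent p) m i = 2 * m - ‖i‖ := by
        rw [tent_apply]
        exact max_eq_left (by linarith [norm_nonneg i])
      change ((1 - ‖i‖ / 2 * (m : ℝ)⁻¹ : ℝ) : 𝕜) • x.1 i =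
        ((2 * m : ℝ)⁻¹ : 𝕜) • ((tent N (normExponent p) m i : 𝕜) • x.1 i)
      rw [h6, smul_smul]
      congr 1
      have h7 : 1 - ‖i‖ / 2 * (m : ℝ)⁻¹ = (2 * m : ℝ)⁻¹ * (2 * m - ‖i‖) := by
        field_simp
      rw [h7]
      push_cast
      ring
  nlinarith

/-- Lower norms of limit operators are almost attained at boundedly supported sequences. -/
theorem IsLimitOperator.exists_bounded_support (hA : IsBandDominated A) {h : ℕ → Lattice N}
    (hB : IsLimitOperator A h B) {x : SeqSpace 𝕜 X N p} (hx : ‖x‖ = 1) {c : ℝ}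
    (hc : ‖B x‖ < c) :
    ∃ y : SeqSpace 𝕜 X N p, y ≠ 0 ∧ ‖B y‖ ≤ c * ‖y‖ ∧ ∃ m : ℕ, ∀ i, y.1 i ≠ 0 → ‖i‖ ≤ m := by
  have hc0 : 0 < c := (norm_nonneg _).trans_lt hc
  have hx0 : x ≠ 0 := by
    rintro rfl
    simp at hx
  have hd : 0 < (c - ‖B x‖) / 2 := by linarith
  have hev := (hB.norm_commutator_tent_le hA hd).and (eventually_gt_atTop 0)
  -- With `d = (c - ‖B x‖) / 2` as commutator error and `δ = d / c`, both sides meet: `c * (1 - δ) =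
  -- ‖B x‖ + d`.
  obtain ⟨m, hm, hcomm, hm0⟩ :=
    ((frequently_norm_tent_ge x hx0 (div_pos hd hc0)).and_eventually hev).exists
  have hm0' : (0 : ℝ) < m := by exact_mod_cast hm0
  have hcomm := hcomm x
  set y := scalarOp 𝕜 X p (tent N (normExponent p) m) x
  rw [hx, mul_one] at hm hcomm
  have h1 : c * (1 - (c - ‖B x‖) / 2 / c) = (c + ‖B x‖) / 2 := by
    field_simp
    ring
  have h2 : ‖scalarOp 𝕜 X p (tent N (normExponent p) m) (B x)‖ ≤ 2 * m * ‖B x‖ := by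
    refine (ContinuousLinearMap.le_opNorm _ _).trans ?_
    gcongr
    refine norm_scalarOp_le _ fun i => ?_
    rw [abs_of_nonneg (tent_nonneg _ _)]
    exact tent_le _ _
  have h3 : 2 * m * ((c + ‖B x‖) / 2) ≤ c * ‖y‖ := by
    rw [← h1, mul_left_comm]
    exact mul_le_mul_of_nonneg_left hm.le hc0.le
  refine ⟨y, fun hy => ?_, ?_, 2 * m, fun i hi => ?_⟩
  · rw [hy, norm_zero, mul_zero] at h3
    have : 0 < 2 * m * ((c + ‖B x‖) / 2) := by positivity
    linarith
  · have := norm_sub_norm_le (B y) (scalarOp 𝕜 X p (tent N (normExponent p) m) (B x))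
    linarith
  · have h4 : (scalarOp 𝕜 X p (tent N (normExponent p) m) x).1 i ≠ 0 := hi
    rw [scalarOp_apply] at h4
    push_cast
    refine norm_le_of_tent_ne_zero (q := normExponent p) fun h0 => h4 ?_
    rw [h0, RCLike.ofReal_zero, zero_smul]

theorem norm_conj_shift_apply (A : SeqSpace 𝕜 X N p →L[𝕜] SeqSpace 𝕜 X N p) (h : Lattice N)
    (x : SeqSpace 𝕜 X N p) :
    ‖(shift 𝕜 X p (-h) * A * shift 𝕜 X p h) x‖ = ‖A (shift 𝕜 X p h x)‖ :=
  norm_shift_apply _ _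

/-- Almost minimizers of a limit operator give almost minimizers of the operator far out. -/
theorem exists_far_of_mem_operatorSpectrum (hA : IsBandDominated A)
    (hB : B ∈ operatorSpectrum A) {x : SeqSpace 𝕜 X N p} (hx : ‖x‖ = 1) {c : ℝ}
    (hc : ‖B x‖ < c) (n : ℕ) :
    ∃ z : SeqSpace 𝕜 X N p, z ≠ 0 ∧ ‖A z‖ ≤ c * ‖z‖ ∧ ∀ i, z.1 i ≠ 0 → n ≤ ‖i‖ := by
  obtain ⟨h, hh, hlim⟩ := hB
  obtain ⟨d, hd1, hd2⟩ := exists_between hc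
  obtain ⟨y, hy, hBy, m, hm⟩ := hlim.exists_bounded_support hA hx hd1
  have hev := (PTendsto.tendsto_norm_sub_mul_proj hlim m).eventually (gt_mem_nhds (sub_pos.2 hd2))
  -- The extra `m` compensates for the radius of the support of `y`.
  have hev2 : ∀ᶠ j in atTop, (n + m : ℝ) ≤ ‖h j‖ := Tendsto.eventually_ge_atTop hh _
  obtain ⟨j, hj, hj2⟩ := (hev.and hev2).exists
  refine ⟨shift 𝕜 X p (h j) y, fun h0 => hy ?_, ?_, fun i hi => ?_⟩
  · rw [← norm_eq_zero, ← norm_shift_apply (h j) y, h0, norm_zero]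
  · rw [← norm_conj_shift_apply, norm_shift_apply]
    have h1 := norm_sub_apply_le_of_support
      (A := shift 𝕜 X p (-h j) * A * shift 𝕜 X p (h j)) (B := B) hm
    have h2 := norm_sub_norm_le ((shift 𝕜 X p (-h j) * A * shift 𝕜 X p (h j)) y) (B y)
    have h3 := mul_le_mul_of_nonneg_right hj.le (norm_nonneg y)
    linarith
  · rw [shift_apply] at hi
    have h1 := hm _ hi
    have h2 := norm_sub_norm_le (h j) i
    rw [norm_sub_rev] at h2
    linarith

/-! ### Lower norms and the minimizing limit operator -/

theorem lowerNorm_nonneg (B : SeqSpace 𝕜 X N p →L[𝕜] SeqSpace 𝕜 X N p) : 0 ≤ lowerNorm B :=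
  Real.sInf_nonneg (by
    rintro _ ⟨y, _, rfl⟩
    exact norm_nonneg _)

theorem lowerNorm_mul_le (B : SeqSpace 𝕜 X N p →L[𝕜] SeqSpace 𝕜 X N p)
    (y : SeqSpace 𝕜 X N p) : lowerNorm B * ‖y‖ ≤ ‖B y‖ := by
  rcases eq_or_ne y 0 with rfl | hy
  · simp
  have hy' : 0 < ‖y‖ := norm_pos_iff.2 hy
  rw [← le_div_iff₀ hy']
  refine csInf_le ⟨0, ?_⟩ ⟨((‖y‖ : 𝕜)⁻¹) • y, norm_smul_inv_norm hy, ?_⟩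
  · rintro _ ⟨y, _, rfl⟩
    exact norm_nonneg _
  · rw [map_smul, norm_smul, norm_inv, RCLike.norm_ofReal, abs_norm, div_eq_inv_mul]

theorem exists_norm_lt_of_lowerNorm_lt [Nontrivial (SeqSpace 𝕜 X N p)] {c : ℝ}
    (h : lowerNorm B < c) : ∃ x : SeqSpace 𝕜 X N p, ‖x‖ = 1 ∧ ‖B x‖ < c := by
  obtain ⟨y, hy⟩ := exists_ne (0 : SeqSpace 𝕜 X N p)
  obtain ⟨_, ⟨x, hx, rfl⟩, hlt⟩ := exists_lt_of_csInf_lt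
    (s := {r : ℝ | ∃ y : SeqSpace 𝕜 X N p, ‖y‖ = 1 ∧ r = ‖B y‖})
    ⟨_, ((‖y‖ : 𝕜)⁻¹) • y, norm_smul_inv_norm hy, rfl⟩ h
  exact ⟨x, hx, hlt⟩

theorem exists_tendsToInfinity (hN : 1 ≤ N) : ∃ h : ℕ → Lattice N, TendsToInfinity h := by
  refine ⟨fun n _ => n, tendsto_atTop_mono (fun n => ?_) tendsto_natCast_atTop_atTop⟩
  have h1 := norm_le_pi_norm (fun _ : Fin N => (n : ℤ)) ⟨0, hN⟩
  rw [Int.norm_natCast] at h1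
  exact h1

theorem IsRich.operatorSpectrum_nonempty (hN : 1 ≤ N) (hA : IsRich A) :
    (operatorSpectrum A).Nonempty := by
  obtain ⟨h, hh⟩ := exists_tendsToInfinity hN
  obtain ⟨φ, hφ, B, hB⟩ := hA.2 h hh
  exact ⟨B, h ∘ φ, hh.comp hφ.tendsto_atTop, hB⟩

/-- The infimum of the lower norms of the limit operators is attained. -/
theorem exists_lowerNorm_le [Nontrivial (SeqSpace 𝕜 X N p)] (hband : IsBandDominated A)
    (hrich : IsRich A) (hne : (operatorSpectrum A).Nonempty) :
    ∃ C ∈ operatorSpectrum A, lowerNorm C ≤ sInf (lowerNorm '' operatorSpectrum A) := by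
  set μ := sInf (lowerNorm '' operatorSpectrum A)
  obtain ⟨r, hr⟩ := hband.nested_localization
  have hstep : ∀ n : ℕ, ∃ h : Lattice N, (n : ℝ) ≤ ‖h‖ ∧ ∀ j ≤ n,
      ∃ z : SeqSpace 𝕜 X N p, z ≠ 0 ∧
        ‖A z‖ ≤ (μ + 1 / ((n : ℝ) + 1) + 2 * (1 / 2) ^ j) * ‖z‖ ∧
          ∀ i, z.1 i ≠ 0 → ‖i - h‖ ≤ r j := by
    intro n
    have hlt : μ < μ + 1 / ((n : ℝ) + 1) := lt_add_of_pos_right _ (by positivity)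
    obtain ⟨_, ⟨B, hB, rfl⟩, hBlt⟩ := exists_lt_of_csInf_lt (hne.image _) hlt
    obtain ⟨x, hx, hBx⟩ := exists_norm_lt_of_lowerNorm_lt hBlt
    obtain ⟨y, hy, hAy, hfar⟩ := exists_far_of_mem_operatorSpectrum hband hB hx hBx n
    obtain ⟨h, hh, hz⟩ := hr n y _ hy hAy
    refine ⟨h, hfar h hh, fun j hj => ?_⟩
    obtain ⟨z, hz0, hAz, hsupp⟩ := hz j hj
    refine ⟨z, hz0, hAz.trans ?_, hsupp⟩
    have : (0 : ℝ) < (1 / 2) ^ n := by positivity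
    gcongr
    linarith
  choose h hh hz using hstep
  have hinf : TendsToInfinity h := tendsto_atTop_mono hh tendsto_natCast_atTop_atTop
  obtain ⟨φ, hφ, C, hC⟩ := hrich.2 h hinf
  refine ⟨C, ⟨h ∘ φ, hinf.comp hφ.tendsto_atTop, hC⟩, ?_⟩
  -- With `j` fixed, the translated pieces `w` lie in one cube of radius `m ≥ r j` for all large
  -- `n`; on that cube the translates of `A` converge to `C` in norm.
  have hbound : ∀ j : ℕ, lowerNorm C ≤ μ + 2 * (1 / 2) ^ j := by
    intro j
    obtain ⟨m, hm⟩ := exists_nat_ge (r j)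
    have hlim1 := PTendsto.tendsto_norm_sub_mul_proj hC m
    have hlim2 : Tendsto (fun n : ℕ => 1 / ((φ n : ℝ) + 1)) atTop (𝓝 0) :=
      (tendsto_one_div_add_atTop_nhds_zero_nat (𝕜 := ℝ)).comp hφ.tendsto_atTop
    have hlim := ((hlim2.const_add μ).add_const (2 * (1 / 2) ^ j)).add hlim1
    rw [add_zero, add_zero] at hlim
    refine ge_of_tendsto hlim ?_
    filter_upwards [eventually_ge_atTop j] with n hn
    obtain ⟨z, hz0, hAz, hsupp⟩ := hz (φ n) j (hn.trans (hφ.id_le n))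
    set w := shift 𝕜 X p (-h (φ n)) z
    have hwz : shift 𝕜 X p (h (φ n)) w = z := shift_shift_neg _ _
    have hw : ‖w‖ = ‖z‖ := norm_shift_apply _ _
    have hw0 : 0 < ‖w‖ := hw ▸ norm_pos_iff.2 hz0
    have hwsupp : ∀ i, w.1 i ≠ 0 → ‖i‖ ≤ m := by
      intro i hi
      have h1 : z.1 (i - -h (φ n)) ≠ 0 := hi
      have h2 := hsupp _ h1
      rw [sub_neg_eq_add, add_sub_cancel_right] at h2
      exact h2.trans hm
    have h1 := norm_conj_shift_apply A (h (φ n)) w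
    rw [hwz] at h1
    rw [← hw] at hAz
    have h2 := norm_sub_apply_le_of_support
      (A := shift 𝕜 X p (-h (φ n)) * A * shift 𝕜 X p (h (φ n))) (B := C) hwsupp
    have h3 := norm_sub_norm_le (C w) ((shift 𝕜 X p (-h (φ n)) * A * shift 𝕜 X p (h (φ n))) w)
    rw [norm_sub_rev] at h3
    have h4 := lowerNorm_mul_le C w
    refine le_of_mul_le_mul_right ?_ hw0
    rw [add_mul]
    change _ ≤ _ + ‖(shift 𝕜 X p (-h (φ n)) * A * shift 𝕜 X p (h (φ n)) - C) *
      proj 𝕜 X N p m‖ * ‖w‖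
    linarith
  have hlim : Tendsto (fun j : ℕ => μ + 2 * (1 / 2 : ℝ) ^ j) atTop (𝓝 μ) := by
    simpa using ((tendsto_pow_atTop_nhds_zero_of_lt_one (r := (1 / 2 : ℝ)) (by norm_num)
      (by norm_num)).const_mul 2).const_add μ
  exact ge_of_tendsto' hlim hbound

end LimitOperators

end LimitOperator

end

theorem theorem8 {𝕜 : Type*} [RCLike 𝕜] {X : Type*} [NormedAddCommGroup X] [NormedSpace 𝕜 X]
    [CompleteSpace X] {N : ℕ} (hN : 1 ≤ N) {p : ENNReal} [Fact (p = 0 ∨ 1 ≤ p)]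
    (A : LimitOperator.SeqSpace 𝕜 X N p →L[𝕜] LimitOperator.SeqSpace 𝕜 X N p)
    (hband : LimitOperator.IsBandDominated A) (hrich : LimitOperator.IsRich A) :
    ∃ C ∈ LimitOperator.operatorSpectrum A,
      IsLeast (LimitOperator.lowerNorm '' LimitOperator.operatorSpectrum A)
        (LimitOperator.lowerNorm C) := by
  have hne := hrich.operatorSpectrum_nonempty hN
  -- On the zero space there are no unit vectors to work with, but all operators coincide.
  rcases subsingleton_or_nontrivial (LimitOperator.SeqSpace 𝕜 X N p) with hs | hs
  · obtain ⟨C, hC⟩ := hne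
    refine ⟨C, hC, ⟨C, hC, rfl⟩, ?_⟩
    rintro _ ⟨B, _, rfl⟩
    rw [Subsingleton.elim C B]
  · obtain ⟨C, hC, hle⟩ := LimitOperator.exists_lowerNorm_le hband hrich hne
    refine ⟨C, hC, ⟨C, hC, rfl⟩, fun b hb => hle.trans (csInf_le ⟨0, ?_⟩ hb)⟩
    rintro _ ⟨B, _, rfl⟩
    exact LimitOperator.lowerNorm_nonneg B
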